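/- A one-counter system (OCS) consists of a finite set of states $Q$, a set of non-zero transitions $T_{>0}\subseteq Q\times\{-1,0,1\}\times Q$, and a set of zero tests $T_{=0}\subseteq Q\times\{0,1\}\times Q$. Its configurations are the pairs in $Q\times\mathbb{N}$, where $\mathbb N=\{0,1,2,\dots\}$; there is an edge $(p,c)\to(q,c+d)$ whenever either $c\ge 1$ and $(p,d,q)\in T_{>0}$, or $c=0$ and $(p,d,q)\in T_{=0}$. Reachability is the reflexive transitive closure of $\to$. A path is a path in the directed graph $(Q\times\mathbb{N},\to)$, in which vertices and edges may be repeated; its length is the number of its (not necessarily distinct) edges. Theorem. Let $\mathcal{O}$ be a one-counter system with $n$ states. Suppose a configuration $\beta=(p_\beta,c_\beta)$ is reachable from a configuration $\alpha=(p_\alpha,c_\alpha)$ in $\mathcal{O}$. Then $\mathcal{O}$ has a path from $\alpha$ to $\beta$ of length at most $14n^2+n\cdot\max(c_\alpha,c_\beta)$. -/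

import Mathlib

/-- A one-counter system with set of states `Q`: a set of non-zero transitions, which is a subset
of `Q × {-1, 0, 1} × Q`, and a set of zero tests, which is a subset of `Q × {0, 1} × Q`.
(Finiteness of `Q` is required where systems are quantified over.) -/
structure OneCounterSystem (Q : Type*) where
  /-- The non-zero transitions. -/
  posTrans : Set (Q × ℤ × Q)
  /-- The zero tests. -/
  zeroTests : Set (Q × ℤ × Q)
  posTrans_effect : ∀ t ∈ posTrans, t.2.1 ∈ ({-1, 0, 1} : Set ℤ)
  zeroTests_effect : ∀ t ∈ zeroTests, t.2.1 ∈ ({0, 1} : Set ℤ)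

namespace OneCounterSystem

variable {Q : Type*}

/-- The one-step relation on configurations `Q × ℕ`: `(p, c) → (q, c + d)` whenever `c ≥ 1` and
`(p, d, q)` is a non-zero transition, or `c = 0` and `(p, d, q)` is a zero test. -/
def Step (S : OneCounterSystem Q) (x y : Q × ℕ) : Prop :=
  ∃ d : ℤ, (y.2 : ℤ) = (x.2 : ℤ) + d ∧
    ((1 ≤ x.2 ∧ (x.1, d, y.1) ∈ S.posTrans) ∨ (x.2 = 0 ∧ (x.1, d, y.1) ∈ S.zeroTests))

/-- Reachability: the reflexive transitive closure of the one-step relation. -/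
def Reachable (S : OneCounterSystem Q) : Q × ℕ → Q × ℕ → Prop :=
  Relation.ReflTransGen S.Step

/-- A path in the directed graph with vertices `Q × ℕ` and edge relation `Step`: a finite
sequence of configurations, each consecutive pair of which is an edge. Vertices and edges may be
repeated. Its `length` is the number of edges, `head` its source and `last` its target. -/
abbrev Path (S : OneCounterSystem Q) : Type _ :=
  RelSeries {e : (Q × ℕ) × (Q × ℕ) | S.Step e.1 e.2}

end OneCounterSystem

/-! Above a floor `lo` at least as large as every simple cycle, a cycle of positive effect can be
iterated freely, and so can a cycle of negative effect, which is a positive one read backwards. Fix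
maximal disjoint families `F` and `G` of such cycles, for the transitions and for their reversals
(`exists_isPumpBasis`). A run leaving the band from `lo` to `hi` must meet a cycle of `F` inside the
band on the way up and one of `G` on the way down (`exists_mem_support`). Between these two points,
the part above the band may be replaced by any free walk whose end levels are right modulo the two
gains: pumping corrects the rest (`exists_pumped_steps`).

This yields an abstract graph of low configurations and stages of flights. A shortest path there is
spliced whenever two flights agree in stage and state, with levels congruent modulo the gcd of the
gain at the start of the earlier one and the gain at the end of the later one
(`not_dvd_of_shortest`). So few vertices use a given cycle: their number is proportional to its
gain, whereas the cost of pumping is proportional to cycle length over gain. The gains cancel, and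
disjointness bounds the sum of the cycle lengths by `n`, so all flights together cost O(n²)
(`weight_sum_le`). -/

namespace OneCounterSystem

/-! ### Walks of prescribed length. -/

/-- `StepsIn r k x y`: there is a sequence of exactly `k` successive `r`-steps from `x` to `y`. -/
def StepsIn {V : Type*} (r : V → V → Prop) : ℕ → V → V → Prop
  | 0, x, y => x = y
  | k + 1, x, y => ∃ z, r x z ∧ StepsIn r k z y

namespace StepsIn

variable {V : Type*} {r r' : V → V → Prop} {x y z : V} {k m : ℕ}

theorem trans (h₁ : StepsIn r k x y) (h₂ : StepsIn r m y z) : StepsIn r (k + m) x z := by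
  induction k generalizing x with
  | zero => cases h₁; simpa using h₂
  | succ k ih =>
    obtain ⟨u, hu, h⟩ := h₁
    rw [Nat.add_right_comm]
    exact ⟨u, hu, ih h⟩

theorem single (h : r x y) : StepsIn r 1 x y := ⟨y, h, rfl⟩

theorem snoc (h₁ : StepsIn r k x y) (h₂ : r y z) : StepsIn r (k + 1) x z := h₁.trans (single h₂)

theorem exists_snoc (h : StepsIn r (k + 1) x z) : ∃ y, StepsIn r k x y ∧ r y z := by
  induction k generalizing x with
  | zero =>
    obtain ⟨u, hu, h⟩ := h
    cases h
    exact ⟨x, rfl, hu⟩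
  | succ k ih =>
    obtain ⟨u, hu, h⟩ := h
    obtain ⟨y, hy, hz⟩ := ih h
    exact ⟨y, ⟨u, hu, hy⟩, hz⟩

theorem mono (hr : ∀ x y, r x y → r' x y) (h : StepsIn r k x y) : StepsIn r' k x y := by
  induction k generalizing x with
  | zero => exact h
  | succ k ih =>
    obtain ⟨u, hu, h⟩ := h
    exact ⟨u, hr _ _ hu, ih h⟩

theorem reverse (hr : ∀ x y, r x y → r' y x) (h : StepsIn r k x y) : StepsIn r' k y x := by
  induction k generalizing x with
  | zero => exact Eq.symm h
  | succ k ih =>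
    obtain ⟨u, hu, h⟩ := h
    exact (ih h).snoc (hr _ _ hu)

theorem exists_fun (h : StepsIn r k x y) :
    ∃ v : ℕ → V, v 0 = x ∧ v k = y ∧ ∀ i < k, r (v i) (v (i + 1)) := by
  induction k generalizing x with
  | zero => exact ⟨fun _ => x, rfl, h, by simp⟩
  | succ k ih =>
    obtain ⟨u, hu, h⟩ := h
    obtain ⟨v, h0, hk, hv⟩ := ih h
    refine ⟨fun i => Nat.casesOn i x v, rfl, hk, ?_⟩
    rintro (_ | i) hi
    · simpa [h0] using hu
    · exact hv i (by omega)

theorem of_fun (v : ℕ → V) {i j : ℕ} (hij : i ≤ j)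
    (hv : ∀ t, i ≤ t → t < j → r (v t) (v (t + 1))) : StepsIn r (j - i) (v i) (v j) := by
  induction j, hij using Nat.le_induction with
  | base => simp [StepsIn]
  | succ j hij ih =>
    rw [Nat.succ_sub hij]
    exact (ih fun t h₁ h₂ => hv t h₁ (by omega)).snoc (hv j hij (by omega))

theorem of_reflTransGen (h : Relation.ReflTransGen r x y) : ∃ k, StepsIn r k x y := by
  induction h with
  | refl => exact ⟨0, rfl⟩
  | tail _ h ih =>
    obtain ⟨k, hk⟩ := ih
    exact ⟨k + 1, hk.snoc h⟩

theorem iterate {f : ℕ → V} (h : ∀ i, StepsIn r k (f i) (f (i + 1))) (m : ℕ) :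
    StepsIn r (m * k) (f 0) (f m) := by
  induction m with
  | zero => simp [StepsIn]
  | succ m ih => rw [Nat.succ_mul]; exact ih.trans (h m)

end StepsIn

variable {Q : Type*}

/-! ### Free walks, with an unrestricted counter. -/

/-- The steps allowed by a set of transitions on `Q × ℤ`, where the counter is unrestricted. -/
def FreeStep (T : Set (Q × ℤ × Q)) (x y : Q × ℤ) : Prop := (x.1, y.2 - x.2, y.1) ∈ T

/-- The transitions read backwards in time. -/
def revTrans (T : Set (Q × ℤ × Q)) : Set (Q × ℤ × Q) := {t | (t.2.2, -t.2.1, t.1) ∈ T}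

theorem freeStep_revTrans {T : Set (Q × ℤ × Q)} {x y : Q × ℤ} :
    FreeStep (revTrans T) x y ↔ FreeStep T y x := by
  simp [FreeStep, revTrans]

theorem StepsIn.rev {T : Set (Q × ℤ × Q)} {k : ℕ} {x y : Q × ℤ}
    (h : StepsIn (FreeStep (revTrans T)) k x y) : StepsIn (FreeStep T) k y x :=
  h.reverse fun _ _ => freeStep_revTrans.1

theorem StepsIn.shift {T : Set (Q × ℤ × Q)} {k : ℕ} {p q : Q} {l m : ℤ}
    (h : StepsIn (FreeStep T) k (p, l) (q, m)) (z : ℤ) :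
    StepsIn (FreeStep T) k (p, l + z) (q, m + z) := by
  induction k generalizing p l with
  | zero => cases h; rfl
  | succ k ih =>
    obtain ⟨⟨u, a⟩, hu, h⟩ := h
    refine ⟨(u, a + z), ?_, ih h⟩
    simpa [FreeStep] using hu

/-- A free walk descends by some `D` and then climbs by some `U`, which are bounded together by
its length; it stays nonnegative as soon as it starts above `D`. -/
theorem StepsIn.exists_drop {S : OneCounterSystem Q} {k : ℕ} {p q : Q} {l m : ℤ}
    (h : StepsIn (FreeStep S.posTrans) k (p, l) (q, m)) :
    ∃ D U : ℤ, 0 ≤ D ∧ 0 ≤ U ∧ D + U ≤ k ∧ m - l = U - D ∧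
      ∀ z : ℤ, D + 1 ≤ l + z →
        StepsIn S.Step k (p, (l + z).toNat) (q, (m + z).toNat) := by
  induction k generalizing p l with
  | zero =>
    cases h
    exact ⟨0, 0, by simp [StepsIn]⟩
  | succ k ih =>
    obtain ⟨⟨u, a⟩, hu, h⟩ := h
    obtain ⟨D, U, hD, hU, hk, he, hr⟩ := ih h
    have hd := S.posTrans_effect _ hu
    simp only [Set.mem_insert_iff, Set.mem_singleton_iff] at hd
    refine ⟨max 0 (D - (a - l)), max 0 (D - (a - l)) + (m - l), le_max_left _ _, ?_, ?_, by ring,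
      fun z hz => ⟨(u, (a + z).toNat), ⟨a - l, ?_, Or.inl ⟨?_, hu⟩⟩, hr z ?_⟩⟩
    · omega
    · push_cast; omega
    · simp only; omega
    · simp only; omega
    · omega

theorem freeStep_of_step {S : OneCounterSystem Q} {x y : Q × ℕ} (hx : 1 ≤ x.2) (h : S.Step x y) :
    FreeStep S.posTrans (x.1, (x.2 : ℤ)) (y.1, (y.2 : ℤ)) := by
  obtain ⟨d, hd, h | h⟩ := h
  · have : (y.2 : ℤ) - x.2 = d := by omega
    simpa [FreeStep, this] using h.2
  · omega

theorem Step.abs_le {S : OneCounterSystem Q} {x y : Q × ℕ} (h : S.Step x y) :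
    y.2 ≤ x.2 + 1 ∧ x.2 ≤ y.2 + 1 := by
  obtain ⟨d, hd, h | h⟩ := h
  · have := S.posTrans_effect _ h.2
    simp only [Set.mem_insert_iff, Set.mem_singleton_iff] at this
    omega
  · have := S.zeroTests_effect _ h.2
    simp only [Set.mem_insert_iff, Set.mem_singleton_iff] at this
    omega

/-! ### Pumps and pump bases. -/

/-- A set of `K.card` states through which the counter can be increased by `gain`: the vertex set
of a simple cycle of positive effect. -/
structure Pump (T : Set (Q × ℤ × Q)) where
  K : Finset Q
  base : Q
  gain : ℕ
  gain_pos : 0 < gain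
  nonempty : K.Nonempty
  loop : ∀ s ∈ K, StepsIn (FreeStep T) K.card (s, 0) (s, gain)
  -- The two legs make up one turn of the cycle. Only `k` is bounded, because only the leg towards
  -- `base` enters the final length; the other leg is needed for connectivity alone.
  conn : ∀ s ∈ K, ∃ (k k' : ℕ) (c c' : ℤ), k ≤ K.card ∧ StepsIn (FreeStep T) k (s, 0) (base, c) ∧
    StepsIn (FreeStep T) k' (base, c') (s, 0) ∧ (gain : ℤ) ∣ c' - c

/-- Take a positive cycle of minimal length. If it repeated a state, the inner loop would have
effect at most 0 by minimality, and cutting it out would leave a shorter positive cycle. Hence it is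
simple. -/
theorem exists_pump {T : Set (Q × ℤ × Q)} (X : Set Q) {k : ℕ} {p : Q} {l l' : ℤ}
    (hl : l < l') (h : StepsIn (FreeStep {t ∈ T | t.1 ∈ X}) k (p, l) (p, l')) :
    ∃ A : Pump T, ∀ s ∈ A.K, s ∈ X := by
  classical
  have hex : ∃ k p l l', l < l' ∧ StepsIn (FreeStep {t ∈ T | t.1 ∈ X}) k (p, l) (p, l') :=
    ⟨k, p, l, l', hl, h⟩
  obtain ⟨p, l, l', hl, h⟩ := Nat.find_spec hex
  have hmin := fun m => Nat.find_min (H := hex) (m := m)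
  generalize Nat.find hex = k at h hmin
  have hmin : ∀ m < k, ∀ p l l', StepsIn (FreeStep {t ∈ T | t.1 ∈ X}) m (p, l) (p, l') →
      l' ≤ l := by
    intro m hm p l l' hh
    by_contra hlt
    exact hmin m hm ⟨p, l, l', by omega, hh⟩
  obtain ⟨v, h0, hk, hv⟩ := h.exists_fun
  have seg : ∀ i j, i ≤ j → j ≤ k →
      StepsIn (FreeStep {t ∈ T | t.1 ∈ X}) (j - i) (v i) (v j) := fun i j hij hj =>
    StepsIn.of_fun v hij fun t _ ht => hv t (by omega)
  have segT : ∀ i j, i ≤ j → j ≤ k → ∀ z,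
      StepsIn (FreeStep T) (j - i) ((v i).1, (v i).2 + z) ((v j).1, (v j).2 + z) :=
    fun i j hij hj z => StepsIn.shift ((seg i j hij hj).mono fun _ _ h => h.1) z
  have hkpos : 0 < k := by
    rcases Nat.eq_zero_or_pos k with rfl | h
    · rw [h0] at hk
      simp only [Prod.mk.injEq, true_and] at hk
      omega
    · exact h
  have hinj : ∀ i j, i < j → j < k → (v i).1 ≠ (v j).1 := by
    intro i j hij hj he
    have h1 := hmin (j - i) (by omega) (v i).1 (v i).2 (v j).2
      (by have := seg i j hij.le hj.le; rwa [show v j = ((v i).1, (v j).2) by rw [he]] at this)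
    have h2 := (seg 0 i i.zero_le (by omega)).shift ((v j).2 - (v i).2)
    have h3 := h2.trans (r := FreeStep {t ∈ T | t.1 ∈ X}) (z := v k) (m := k - j)
      (by have := seg j k hj.le le_rfl; rwa [show v j = ((v i).1, (v i).2 + ((v j).2 - (v i).2)) by
            rw [he]; ext <;> simp] at this)
    rw [hk, h0] at h3
    have := hmin _ (by simp; omega) _ _ _ h3
    omega
  have hinj' : Set.InjOn (fun i => (v i).1) (Finset.range k : Finset ℕ) := by
    intro i hi j hj he
    simp only [Finset.coe_range, Set.mem_Iio] at hi hj
    rcases lt_trichotomy i j with hij | hij | hij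
    · exact absurd he (hinj i j hij hj)
    · exact hij
    · exact absurd he.symm (hinj j i hij hi)
  have hcard : ((Finset.range k).image fun i => (v i).1).card = k := by
    rw [Finset.card_image_of_injOn hinj', Finset.card_range]
  have hg : (((l' - l).toNat : ℕ) : ℤ) = l' - l := by omega
  refine ⟨⟨(Finset.range k).image fun i => (v i).1, p, (l' - l).toNat, by omega,
    ⟨_, Finset.mem_image_of_mem _ (Finset.mem_range.2 hkpos)⟩, ?_, ?_⟩, ?_⟩
  · intro s hs
    obtain ⟨i, hi, rfl⟩ := Finset.mem_image.1 hs
    rw [Finset.mem_range] at hi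
    rw [hcard]
    have h1 := segT i k hi.le le_rfl (-(v i).2)
    have h2 := segT 0 i i.zero_le hi.le (-(v i).2 + l' - l)
    rw [hk] at h1
    rw [h0] at h2
    have h3 := h1.trans (z := ((v i).1, (v i).2 + (-(v i).2 + l' - l))) (m := i - 0)
      (by convert h2 using 2; ring)
    rw [show k - i + (i - 0) = k by omega] at h3
    convert h3 using 2
    · ring
    · rw [hg]; ring
  · intro s hs
    obtain ⟨i, hi, rfl⟩ := Finset.mem_image.1 hs
    rw [Finset.mem_range] at hi
    rw [hcard]
    have h1 := segT i k hi.le le_rfl (-(v i).2)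
    have h2 := segT 0 i i.zero_le hi.le (-(v i).2)
    rw [hk] at h1
    rw [h0] at h2
    refine ⟨k - i, i - 0, l' + -(v i).2, l + -(v i).2, by omega, ?_, ?_, ?_⟩
    · convert h1 using 2; ring
    · convert h2 using 2; ring
    · rw [hg]; exact ⟨-1, by ring⟩
  · intro s hs
    obtain ⟨i, hi, rfl⟩ := Finset.mem_image.1 hs
    exact (hv i (Finset.mem_range.1 hi)).2

theorem Pump.conn_at {T : Set (Q × ℤ × Q)} (A : Pump T) {s : Q} (hs : s ∈ A.K) (h : ℤ) :
    ∃ (k k' : ℕ) (c c' : ℤ), k ≤ A.K.card ∧ StepsIn (FreeStep T) k (s, h) (A.base, c) ∧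
      StepsIn (FreeStep T) k' (A.base, c') (s, h) ∧ (A.gain : ℤ) ∣ c' - c := by
  obtain ⟨k, k', c, c', hk, h1, h2, hd⟩ := A.conn s hs
  refine ⟨k, k', c + h, c' + h, hk, ?_, ?_, by simpa using hd⟩
  · simpa using h1.shift h
  · simpa using h2.shift h

/-- The states covered by a family of pumps. -/
noncomputable def support {T : Set (Q × ℤ × Q)} (F : Finset (Pump T)) : Finset Q :=
  open Classical in F.biUnion Pump.K

/-- A disjoint family of pumps which no cycle of positive effect avoids. -/
structure IsPumpBasis {T : Set (Q × ℤ × Q)} (F : Finset (Pump T)) : Prop where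
  disj : (F : Set (Pump T)).PairwiseDisjoint Pump.K
  covers : ∀ (k : ℕ) (p : Q) (l l' : ℤ),
    StepsIn (FreeStep {t ∈ T | t.1 ∉ support F}) k (p, l) (p, l') → l' ≤ l

/-- Greedy choice: a positive cycle avoiding the support contains a pump disjoint from the family,
and adding it decreases the number of uncovered states. -/
theorem exists_isPumpBasis [Fintype Q] (T : Set (Q × ℤ × Q)) :
    ∃ F : Finset (Pump T), IsPumpBasis F := by
  classical
  suffices H : ∀ (m : ℕ) (F : Finset (Pump T)), (F : Set (Pump T)).PairwiseDisjoint Pump.K →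
      Fintype.card Q - (support F).card = m → ∃ F : Finset (Pump T), IsPumpBasis F from
    H _ ∅ (by simp) rfl
  intro m
  induction m using Nat.strong_induction_on with
  | _ m ih =>
  intro F hF hm
  by_cases hc : ∀ (k : ℕ) (p : Q) (l l' : ℤ),
      StepsIn (FreeStep {t ∈ T | t.1 ∉ support F}) k (p, l) (p, l') → l' ≤ l
  · exact ⟨F, hF, hc⟩
  push Not at hc
  obtain ⟨k, p, l, l', h, hl⟩ := hc
  obtain ⟨A, hA⟩ := exists_pump (T := T) {q | q ∉ support F} hl h
  obtain ⟨s, hs⟩ := A.nonempty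
  have hlt : (support F).card < (support (insert A F)).card := by
    apply Finset.card_lt_card
    rw [Finset.ssubset_iff_of_subset]
    · exact ⟨s, by simp [support, hs], hA s hs⟩
    · intro q hq
      simp only [support, Finset.mem_biUnion, Finset.mem_insert] at hq ⊢
      obtain ⟨B, hB, hq⟩ := hq
      exact ⟨B, Or.inr hB, hq⟩
  refine ih _ ?_ (insert A F) ?_ rfl
  · have := (support (insert A F)).card_le_univ
    omega
  · rw [Finset.coe_insert, Set.pairwiseDisjoint_insert]
    refine ⟨hF, fun B hB _ => Finset.disjoint_left.2 fun q hq hq' => hA q hq ?_⟩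
    simp only [support, Finset.mem_biUnion]
    exact ⟨B, hB, hq'⟩

theorem card_le_card_support {T : Set (Q × ℤ × Q)} {F : Finset (Pump T)} {A : Pump T}
    (hA : A ∈ F) : A.K.card ≤ (support F).card := by
  classical
  exact Finset.card_le_card (Finset.subset_biUnion_of_mem _ hA)

theorem IsPumpBasis.sum_card_le [Fintype Q] {T : Set (Q × ℤ × Q)} {F : Finset (Pump T)}
    (hF : IsPumpBasis F) : ∑ A ∈ F, A.K.card ≤ Fintype.card Q := by
  classical
  rw [← Finset.card_biUnion hF.disj]
  exact Finset.card_le_univ _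

/-! ### Realizing free walks by pumping. -/

theorem Pump.gain_le {S : OneCounterSystem Q} (A : Pump S.posTrans) : A.gain ≤ A.K.card := by
  obtain ⟨s, hs⟩ := A.nonempty
  obtain ⟨D, U, hD, hU, hk, he, hr⟩ := (A.loop s hs).exists_drop
  omega

theorem Pump.gain_le_of_rev {S : OneCounterSystem Q} (B : Pump (revTrans S.posTrans)) :
    B.gain ≤ B.K.card := by
  obtain ⟨s, hs⟩ := B.nonempty
  obtain ⟨D, U, hD, hU, hk, he, hr⟩ := (B.loop s hs).rev.exists_drop
  omega

/-- In one turn `D + U ≤ A.K.card` and `U - D > 0`, so the counter drops by less than `A.K.card` and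
stays positive. -/
theorem Pump.stepsIn_climb {S : OneCounterSystem Q} (A : Pump S.posTrans) {s : Q}
    (hs : s ∈ A.K) {h : ℕ} (hh : A.K.card ≤ h) (x : ℕ) :
    StepsIn S.Step (x * A.K.card) (s, h) (s, h + x * A.gain) := by
  have H := StepsIn.iterate (r := S.Step) (k := A.K.card) (f := fun i => (s, h + i * A.gain))
    (fun i => by
      obtain ⟨D, U, hD, hU, hk, he, hr⟩ := (A.loop s hs).exists_drop
      have := A.gain_pos
      simp only [Nat.succ_mul]
      generalize i * A.gain = g
      convert hr (h + g : ℕ) (by omega) using 2 <;> omega) x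
  simpa using H

theorem Pump.stepsIn_descend {S : OneCounterSystem Q} (B : Pump (revTrans S.posTrans)) {t : Q}
    (ht : t ∈ B.K) {h : ℕ} (hh : B.K.card ≤ h) (y : ℕ) :
    StepsIn S.Step (y * B.K.card) (t, h + y * B.gain) (t, h) := by
  have H := StepsIn.iterate (r := fun a b => S.Step b a) (k := B.K.card)
    (f := fun i => (t, h + i * B.gain))
    (fun i => by
      obtain ⟨D, U, hD, hU, hk, he, hr⟩ := (B.loop t ht).rev.exists_drop
      have := B.gain_pos
      have := B.gain_le_of_rev
      simp only [Nat.succ_mul]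
      generalize i * B.gain = g
      refine StepsIn.reverse (r := S.Step) (fun _ _ h => h) ?_
      convert hr (h + g : ℕ) (by omega) using 2 <;> omega) y
  simpa using StepsIn.reverse (r' := S.Step) (fun _ _ h => h) H

/-- A free walk whose start and end are only correct up to multiples of the gains of the two pumps
at its ends can be realized by pumping. -/
theorem exists_pumped_steps {S : OneCounterSystem Q} {A : Pump S.posTrans}
    {B : Pump (revTrans S.posTrans)} {s t : Q} (hs : s ∈ A.K) (ht : t ∈ B.K) {h h' w : ℕ}
    (hA : A.K.card ≤ h) (hB : B.K.card ≤ h') (hw : h ≤ h' + w) (hw' : h' ≤ h + w)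
    {k : ℕ} {α β : ℤ}
    (hwalk : StepsIn (FreeStep S.posTrans) k (s, (h : ℤ))
      (t, (h' : ℤ) + B.gain * β - A.gain * α)) :
    ∃ x y : ℕ, x * A.gain ≤ k + w + A.gain.lcm B.gain ∧ y * B.gain ≤ k + w + A.gain.lcm B.gain ∧
      StepsIn S.Step (x * A.K.card + k + y * B.K.card) (s, h) (t, h') := by
  obtain ⟨D, U, hD, hU, hk, he, hr⟩ := hwalk.exists_drop
  set a := A.gain with ha
  set b := B.gain with hb
  have ha0 : 0 < a := A.gain_pos
  have hb0 : 0 < b := B.gain_pos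
  have hc := A.nonempty.card_pos
  have hc' := B.nonempty.card_pos
  obtain ⟨b', hb'⟩ := Nat.dvd_lcm_left a b
  obtain ⟨a', ha'⟩ := Nat.dvd_lcm_right a b
  have hL0 : 0 < a.lcm b := Nat.lcm_pos ha0 hb0
  generalize a.lcm b = L at *
  have hb'' : (L : ℤ) = a * b' := by exact_mod_cast hb'
  have ha'' : (L : ℤ) = b * a' := by exact_mod_cast ha'
  have hL0' : (0 : ℤ) < L := by exact_mod_cast hL0
  -- `N` is the least height to pump up: nonnegative, high enough to keep the walk positive, and
  -- high enough that the amount pumped down is nonnegative. Rounding up within the class of `a * α`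
  -- modulo `L` costs less than `L`; adding `L * κ` to both amounts preserves the end levels.
  obtain ⟨N, hN⟩ : ∃ N : ℤ, N = max (max 0 (D + 1 - h)) (a * α - b * β) := ⟨_, rfl⟩
  have e1 := Int.emod_nonneg (a * α - N) hL0'.ne'
  have e2 := Int.emod_lt_of_pos (a * α - N) hL0'
  have e3 := Int.emod_add_mul_ediv (a * α - N) L
  obtain ⟨κ, hκ⟩ : ∃ κ : ℤ, κ = -((a * α - N) / L) := ⟨_, rfl⟩
  have e4 : (L : ℤ) * ((a * α - N) / L) = - (L * κ) := by rw [hκ]; ring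
  have hx : (α + b' * κ) * a = a * α + L * κ := by rw [hb'']; ring
  have hy : (β + a' * κ) * b = b * β + L * κ := by rw [ha'']; ring
  have hx0 : 0 ≤ α + b' * κ := by
    refine nonneg_of_mul_nonneg_left (b := (a : ℤ)) ?_ (by exact_mod_cast ha0)
    omega
  have hy0 : 0 ≤ β + a' * κ := by
    refine nonneg_of_mul_nonneg_left (b := (b : ℤ)) ?_ (by exact_mod_cast hb0)
    omega
  obtain ⟨x, hx'⟩ := Int.eq_ofNat_of_zero_le hx0
  obtain ⟨y, hy'⟩ := Int.eq_ofNat_of_zero_le hy0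
  rw [hx'] at hx
  rw [hy'] at hy
  have hr := hr (x * a : ℕ) (by push_cast; omega)
  refine ⟨x, y, ?_, ?_, ?_⟩
  · zify; omega
  · zify; omega
  · refine ((A.stepsIn_climb hs hA x).trans ?_).trans (B.stepsIn_descend ht hB y)
    rw [← ha, ← hb]
    convert hr using 2
    zify
    rw [Int.toNat_of_nonneg]
    · omega
    · push_cast
      have : (0 : ℤ) ≤ y * b := by positivity
      omega

/-! ### The abstract graph and the splicing of flights. -/

/-- The phases of a flight, during which the counter is only known up to multiples of the gains of
two pumps. -/
inductive Phase
  | takeoff | cruise | landing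

/-- The vertices of the abstract graph: configurations with a small counter, and the stages of
flights that start with pumping in `A` and end with pumping in `B`. -/
inductive Node (S : OneCounterSystem Q)
  | low (q : Q) (h : ℕ)
  | mid (A : Pump S.posTrans) (B : Pump (revTrans S.posTrans)) (f : Phase) (q : Q) (l : ℤ)

/-- The edges of the abstract graph. -/
inductive Edge {S : OneCounterSystem Q} (F : Finset (Pump S.posTrans))
    (G : Finset (Pump (revTrans S.posTrans))) (lo hi : ℕ) : Node S → Node S → Prop
  | step {p q : Q} {h h' : ℕ} : S.Step (p, h) (q, h') → h ≤ hi → h' ≤ hi →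
      Edge F G lo hi (.low p h) (.low q h')
  | enter {A B} {s : Q} {h k : ℕ} {l c : ℤ} : A ∈ F → B ∈ G → s ∈ A.K → lo ≤ h → h ≤ hi →
      k ≤ A.K.card → StepsIn (FreeStep S.posTrans) k (s, (h : ℤ)) (A.base, c) →
      (A.gain : ℤ) ∣ l - c → Edge F G lo hi (.low s h) (.mid A B .takeoff A.base l)
  | leave {A B} {q : Q} {l : ℤ} :
      Edge F G lo hi (.mid A B .takeoff q l) (.mid A B .cruise q l)
  | fly {A B} {q q' : Q} {l l' : ℤ} : FreeStep S.posTrans (q, l) (q', l') →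
      Edge F G lo hi (.mid A B .cruise q l) (.mid A B .cruise q' l')
  | land {A B} {q : Q} {l : ℤ} :
      Edge F G lo hi (.mid A B .cruise q l) (.mid A B .landing q l)
  | exit {A B} {t : Q} {h k : ℕ} {l c : ℤ} : A ∈ F → B ∈ G → t ∈ B.K → lo ≤ h → h ≤ hi →
      k ≤ B.K.card → StepsIn (FreeStep (revTrans S.posTrans)) k (t, (h : ℤ)) (B.base, c) →
      (B.gain : ℤ) ∣ l - c → Edge F G lo hi (.mid A B .landing B.base l) (.low t h)

section

variable {S : OneCounterSystem Q} {F : Finset (Pump S.posTrans)}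
  {G : Finset (Pump (revTrans S.posTrans))} {lo hi : ℕ}

theorem FreeStep.shift {T : Set (Q × ℤ × Q)} {p q : Q} {l m : ℤ}
    (h : FreeStep T (p, l) (q, m)) (z : ℤ) : FreeStep T (p, l + z) (q, m + z) := by
  simpa [FreeStep] using h

/-- Before the landing, `B` is a mere label, and `enter` fixes the level only modulo `A.gain`; so
the whole initial part of the flight can be relabelled and shifted. -/
theorem StepsIn.change_target {k : ℕ} {x q : Q} {h : ℕ} {A B B'} {f : Phase} {l l' : ℤ}
    (hk : StepsIn (Edge F G lo hi) k (.low x h) (.mid A B f q l)) (hB : B' ∈ G)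
    (hl : (A.gain : ℤ) ∣ l' - l) :
    StepsIn (Edge F G lo hi) k (.low x h) (.mid A B' f q l') := by
  induction k generalizing f q l l' with
  | zero => cases hk
  | succ k ih =>
    obtain ⟨y, hy, he⟩ := hk.exists_snoc
    cases he with
    | enter h1 h2 h3 h4 h5 h6 h7 h8 =>
      exact hy.snoc (.enter h1 hB h3 h4 h5 h6 h7 (by simpa using dvd_add hl h8))
    | leave => exact (ih hy hl).snoc .leave
    | @fly _ _ q0 _ l0 _ h1 =>
      refine (ih (l' := l0 + (l' - l)) hy (by simpa using hl)).snoc (.fly ?_)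
      simpa using h1.shift (l' - l)
    | land => exact (ih hy hl).snoc .land

/-- The mirror image: what remains of a flight depends on its starting pump only as a label, and on
the level only modulo `B.gain`. -/
theorem StepsIn.change_source {k : ℕ} {y q : Q} {h : ℕ} {A A' B} {f : Phase} {l l' : ℤ}
    (hk : StepsIn (Edge F G lo hi) k (.mid A B f q l) (.low y h)) (hA : A' ∈ F)
    (hl : (B.gain : ℤ) ∣ l' - l) :
    StepsIn (Edge F G lo hi) k (.mid A' B f q l') (.low y h) := by
  induction k generalizing f q l l' with
  | zero => cases hk
  | succ k ih =>
    obtain ⟨y, he, hy⟩ := hk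
    cases he with
    | exit h1 h2 h3 h4 h5 h6 h7 h8 =>
      exact ⟨_, .exit hA h2 h3 h4 h5 h6 h7 (by simpa using dvd_add hl h8), hy⟩
    | leave => exact ⟨_, .leave, ih hy hl⟩
    | @fly _ _ _ q0 _ l0 h1 =>
      refine ⟨_, .fly (l' := l0 + (l' - l)) ?_, ih hy (by simpa using hl)⟩
      simpa using h1.shift (l' - l)
    | land => exact ⟨_, .land, ih hy hl⟩

theorem mem_of_stepsIn_mid {k : ℕ} {x q : Q} {h : ℕ} {A B} {f : Phase} {l : ℤ}
    (hk : StepsIn (Edge F G lo hi) k (.low x h) (.mid A B f q l)) : A ∈ F ∧ B ∈ G := by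
  induction k generalizing f q l with
  | zero => cases hk
  | succ k ih =>
    obtain ⟨y, hy, he⟩ := hk.exists_snoc
    cases he with
    | enter h1 h2 => exact ⟨h1, h2⟩
    | leave => exact ih hy
    | fly => exact ih hy
    | land => exact ih hy

theorem base_of_stepsIn_takeoff {k : ℕ} {x q : Q} {h : ℕ} {A B} {l : ℤ}
    (hk : StepsIn (Edge F G lo hi) k (.low x h) (.mid A B .takeoff q l)) : q = A.base := by
  cases k with
  | zero => cases hk
  | succ k =>
    obtain ⟨y, hy, he⟩ := hk.exists_snoc
    cases he
    rfl

theorem base_of_landing_stepsIn {k : ℕ} {y q : Q} {h : ℕ} {A B} {l : ℤ}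
    (hk : StepsIn (Edge F G lo hi) k (.mid A B .landing q l) (.low y h)) : q = B.base := by
  cases k with
  | zero => cases hk
  | succ k =>
    obtain ⟨y, he, hy⟩ := hk
    cases he
    rfl

/-- On a shortest path of the abstract graph, flights do not meet up to the periods of pumping. -/
theorem not_dvd_of_shortest {n : ℕ} {x y : Q} {h h' : ℕ}
    (hmin : ∀ m < n, ¬ StepsIn (Edge F G lo hi) m (.low x h) (.low y h'))
    {i j : ℕ} (hij : i < j) (hj : j ≤ n) {A B A' B'} {f : Phase} {q : Q} {l l' : ℤ}
    (h₁ : StepsIn (Edge F G lo hi) i (.low x h) (.mid A B f q l))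
    (h₂ : StepsIn (Edge F G lo hi) j (.low x h) (.mid A' B' f q l'))
    (h₃ : StepsIn (Edge F G lo hi) (n - j) (.mid A' B' f q l') (.low y h')) :
    ¬ ((A.gain.gcd B'.gain : ℕ) : ℤ) ∣ l - l' := by
  rintro ⟨z, hz⟩
  rw [Nat.gcd_eq_gcd_ab] at hz
  have hB := (mem_of_stepsIn_mid h₂).2
  have hA := (mem_of_stepsIn_mid h₁).1
  -- By Bézout, this level differs from `l` by a multiple of `A.gain` and from `l'` by a multiple of
  -- `B'.gain`; the two halves are joined there.
  have e₁ := h₁.change_target (l' := l - A.gain * (A.gain.gcdA B'.gain * z)) hB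
    ⟨-(A.gain.gcdA B'.gain * z), by ring⟩
  have e₂ := h₃.change_source (l' := l - A.gain * (A.gain.gcdA B'.gain * z)) hA
    ⟨A.gain.gcdB B'.gain * z, by linear_combination hz⟩
  exact hmin _ (by omega) (e₁.trans e₂)

end

/-! ### From runs to walks in the abstract graph. -/

/-- A walk that climbs through a sufficiently wide band of levels meets a pump within the band. -/
theorem exists_mem_support [Fintype Q] {T : Set (Q × ℤ × Q)} {F : Finset (Pump T)}
    (hF : IsPumpBasis F) (c : ℕ → Q × ℤ) (τ : ℕ) (lo w : ℤ)
    (hw : (Fintype.card Q : ℤ) - (support F).card ≤ w) (h0 : (c 0).2 = lo)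
    (hτ : (c τ).2 = lo + w + 1) (hlo : ∀ i < τ, lo ≤ (c i).2)
    (hs : ∀ i < τ, (c (i + 1)).2 ≤ (c i).2 + 1)
    (hc : ∀ i < τ, FreeStep T (c i) (c (i + 1))) : ∃ i < τ, (c i).1 ∈ support F := by
  classical
  by_contra! hno
  -- Last visits to the `w + 1` levels of the band occur in increasing order of level. With at most
  -- `w` uncovered states, two of them share a state and bound a positive cycle off the support.
  have hlast : ∀ l : ℤ, lo ≤ l → l ≤ lo + w →
      ∃ i < τ, (c i).2 = l ∧ ∀ j, i < j → j ≤ τ → l < (c j).2 := by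
    intro l hl hl'
    have h1 := Nat.findGreatest_spec (P := fun i => (c i).2 ≤ l) (Nat.zero_le τ) (by omega)
    have h2 := Nat.findGreatest_le (P := fun i => (c i).2 ≤ l) τ
    have h3 := fun k => Nat.findGreatest_is_greatest (P := fun i => (c i).2 ≤ l) (n := τ) (k := k)
    generalize Nat.findGreatest (fun i => (c i).2 ≤ l) τ = i at h1 h2 h3
    have hi : i < τ := by
      rcases h2.lt_or_eq with h | h
      · exact h
      · subst h; omega
    refine ⟨i, hi, le_antisymm h1 ?_, fun j hj hj' => not_le.1 (h3 j hj hj')⟩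
    have := hs i hi
    have := h3 (i + 1) (by omega) (by omega)
    omega
  choose! t ht htl hgt using hlast
  have hmaps : ∀ l ∈ Finset.Icc lo (lo + w), (c (t l)).1 ∈ (support F)ᶜ := by
    intro l hl
    rw [Finset.mem_Icc] at hl
    exact Finset.mem_compl.2 (hno _ (ht l hl.1 hl.2))
  have hcard : (support F)ᶜ.card < (Finset.Icc lo (lo + w)).card := by
    rw [Finset.card_compl, Int.card_Icc]
    have := (support F).card_le_univ
    omega
  obtain ⟨l, hl, l', hl', hne, he⟩ :=
    Finset.exists_ne_map_eq_of_card_lt_of_maps_to hcard hmaps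
  wlog hlt : l < l' generalizing l l'
  · exact this l' hl' l hl hne.symm he.symm (by omega)
  rw [Finset.mem_Icc] at hl hl'
  have htt : t l < t l' := by
    by_contra! hle
    have e1 := htl l hl.1 hl.2
    have e2 := htl l' hl'.1 hl'.2
    rcases hle.lt_or_eq with h | h
    · have := hgt l' hl'.1 hl'.2 (t l) h (ht l hl.1 hl.2).le
      omega
    · rw [h] at e2; omega
  have h1 := StepsIn.of_fun (r := FreeStep {t ∈ T | t.1 ∉ support F}) c htt.le (by
    intro i hi hi'
    have := ht l' hl'.1 hl'.2
    exact ⟨hc i (by omega), hno i (by omega)⟩)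
  have e1 : c (t l) = ((c (t l)).1, l) := Prod.ext rfl (htl l hl.1 hl.2)
  have e2 : c (t l') = ((c (t l)).1, l') := Prod.ext he.symm (htl l' hl'.1 hl'.2)
  rw [e2, e1] at h1
  have := hF.covers _ _ _ _ h1
  omega

section
variable {S : OneCounterSystem Q} {F : Finset (Pump S.posTrans)}
  {G : Finset (Pump (revTrans S.posTrans))} {lo hi : ℕ}

theorem reflTransGen_low (v : ℕ → Q × ℕ) {i j : ℕ} (hij : i ≤ j)
    (hv : ∀ t, i ≤ t → t < j → S.Step (v t) (v (t + 1))) (hle : ∀ t, i ≤ t → t ≤ j → (v t).2 ≤ hi) :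
    Relation.ReflTransGen (Edge F G lo hi) (.low (v i).1 (v i).2) (.low (v j).1 (v j).2) := by
  induction j, hij using Nat.le_induction with
  | base => exact .refl
  | succ j hij ih =>
    exact (ih (fun t h h' => hv t h (by omega)) fun t h h' => hle t h (by omega)).tail
      (.step (hv j hij (by omega)) (hle j hij (by omega)) (hle _ (by omega) le_rfl))

theorem reflTransGen_cruise {A B} {k : ℕ} {q q' : Q} {l l' : ℤ}
    (h : StepsIn (FreeStep S.posTrans) k (q, l) (q', l')) :
    Relation.ReflTransGen (Edge F G lo hi) (.mid A B .cruise q l) (.mid A B .cruise q' l') := by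
  induction k generalizing q l with
  | zero => cases h; exact .refl
  | succ k ih =>
    obtain ⟨⟨u, m⟩, hu, h⟩ := h
    exact .head (.fly hu) (ih h)

/-- The abstract flight goes from `s` to the base of `A`, jumps to a congruent level, returns to
`(s, h)` as part of the free walk, and treats `B` symmetrically. -/
theorem reflTransGen_flight {A B} (hA : A ∈ F) (hB : B ∈ G) {s t : Q} (hs : s ∈ A.K) (ht : t ∈ B.K)
    {h h' k : ℕ} (hh : lo ≤ h) (hh₁ : h ≤ hi) (hh' : lo ≤ h') (hh₁' : h' ≤ hi)
    (hw : StepsIn (FreeStep S.posTrans) k (s, (h : ℤ)) (t, (h' : ℤ))) :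
    Relation.ReflTransGen (Edge F G lo hi) (.low s h) (.low t h') := by
  obtain ⟨k₁, k₂, c, c', hk, h1, h2, hd⟩ := A.conn_at hs h
  obtain ⟨k₃, k₄, d, d', hk', h3, h4, hd'⟩ := B.conn_at ht h'
  exact ((((Relation.ReflTransGen.single (.enter (B := B) hA hB hs hh hh₁ hk h1 hd)).tail
    .leave).trans (reflTransGen_cruise ((h2.trans hw).trans h4.rev))).tail .land).tail
    (.exit hA hB ht hh' hh₁' hk' h3 hd')

/-- The first excursion above `hi`, taken between consecutive visits to the floor, uses no zero test
since `lo ≥ 1`. Its first climb and its last descent cross the band and supply the two pumps; the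
rest of the run follows by induction. -/
theorem reflTransGen_of_steps [Fintype Q] (hF : IsPumpBasis F) (hG : IsPumpBasis G) {w : ℕ}
    (hlo : 1 ≤ lo) (hwF : Fintype.card Q - (support F).card ≤ w)
    (hwG : Fintype.card Q - (support G).card ≤ w) (hhi : hi = lo + w) (N : ℕ) (v : ℕ → Q × ℕ)
    (hv : ∀ i < N, S.Step (v i) (v (i + 1))) (h0 : (v 0).2 ≤ lo) (hN : (v N).2 ≤ lo) :
    Relation.ReflTransGen (Edge F G lo hi) (.low (v 0).1 (v 0).2) (.low (v N).1 (v N).2) := by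
  induction N using Nat.strong_induction_on generalizing v with
  | _ N ih =>
  by_cases hall : ∀ i ≤ N, (v i).2 ≤ hi
  · exact reflTransGen_low v N.zero_le (fun t _ h => hv t h) fun t _ h => hall t h
  have hstep : ∀ i < N, (v (i + 1)).2 ≤ (v i).2 + 1 ∧ (v i).2 ≤ (v (i + 1)).2 + 1 :=
    fun i h => (hv i h).abs_le
  -- the first time above the band
  obtain ⟨τ, hτN, hτ, hτ'⟩ : ∃ τ ≤ N, hi < (v τ).2 ∧ ∀ i < τ, (v i).2 ≤ hi := by
    push Not at hall
    obtain ⟨i, hiN, hi'⟩ := hall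
    have hex : ∃ i, hi < (v i).2 := ⟨i, hi'⟩
    refine ⟨Nat.find hex, (Nat.find_min' hex hi').trans hiN, Nat.find_spec hex, fun j hj => ?_⟩
    exact not_lt.1 (Nat.find_min hex hj)
  -- the last visit to the floor of the band before that
  obtain ⟨i₀, hi₀, hfl, hi₀'⟩ : ∃ i₀ ≤ τ, (v i₀).2 ≤ lo ∧ ∀ i, i₀ < i → i ≤ τ → lo < (v i).2 :=
    ⟨Nat.findGreatest (fun i => (v i).2 ≤ lo) τ, Nat.findGreatest_le _,
      Nat.findGreatest_spec (P := fun i => (v i).2 ≤ lo) (Nat.zero_le τ) h0,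
      fun i h h' => not_le.1 (Nat.findGreatest_is_greatest (P := fun i => (v i).2 ≤ lo) h h')⟩
  -- the first return to the floor
  obtain ⟨τ₂, hτ₂, hτ₂N, hfl₂, hτ₂'⟩ : ∃ τ₂, τ < τ₂ ∧ τ₂ ≤ N ∧ (v τ₂).2 ≤ lo ∧
      ∀ i, τ ≤ i → i < τ₂ → lo < (v i).2 := by
    have hex : ∃ i, τ < i ∧ (v i).2 ≤ lo := by
      refine ⟨N, lt_of_le_of_ne hτN ?_, hN⟩
      rintro rfl; omega
    obtain ⟨h1, h2⟩ := Nat.find_spec hex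
    refine ⟨Nat.find hex, h1, Nat.find_min' hex ⟨lt_of_le_of_ne hτN ?_, hN⟩, h2, fun i h h' => ?_⟩
    · rintro rfl; omega
    · rcases h.lt_or_eq with h | rfl
      · have := Nat.find_min hex h'
        push Not at this
        exact this h
      · omega
  -- the last time above the band before the return
  obtain ⟨σ, hσ, hσ₂, hσhi, hσ'⟩ : ∃ σ, τ ≤ σ ∧ σ ≤ τ₂ ∧ hi < (v σ).2 ∧
      ∀ i, σ < i → i ≤ τ₂ → (v i).2 ≤ hi :=
    ⟨Nat.findGreatest (fun i => hi < (v i).2) τ₂, Nat.le_findGreatest hτ₂.le hτ,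
      Nat.findGreatest_le _, Nat.findGreatest_spec (P := fun i => hi < (v i).2) hτ₂.le hτ,
      fun i h h' => not_lt.1 (Nat.findGreatest_is_greatest (P := fun i => hi < (v i).2) h h')⟩
  have hi₀lt : i₀ < τ := lt_of_le_of_ne hi₀ (by rintro rfl; omega)
  have hσlt : σ < τ₂ := lt_of_le_of_ne hσ₂ (by rintro rfl; omega)
  have hmid : ∀ i, i₀ < i → i < τ₂ → lo < (v i).2 := fun i h h' => by
    rcases le_total i τ with h'' | h''
    · exact hi₀' i h h''
    · exact hτ₂' i h'' h'
  have hv₀ : (v i₀).2 = lo := by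
    have := hi₀' (i₀ + 1) (by omega) (by omega)
    have := hstep i₀ (by omega)
    omega
  have hv₂ : (v τ₂).2 = lo := by
    have := hmid (τ₂ - 1) (by omega) (by omega)
    have := hstep (τ₂ - 1) (by omega)
    rw [Nat.sub_add_cancel (by omega)] at this
    omega
  have hvτ : (v τ).2 = hi + 1 := by
    have := hτ' (τ - 1) (by omega)
    have := hstep (τ - 1) (by omega)
    rw [Nat.sub_add_cancel (by omega)] at this
    omega
  have hvσ : (v σ).2 = hi + 1 := by
    have := hσ' (σ + 1) (by omega) (by omega)
    have := hstep σ (by omega)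
    omega
  have hfree : ∀ i, i₀ ≤ i → i < τ₂ → FreeStep S.posTrans ((v i).1, ((v i).2 : ℤ))
      ((v (i + 1)).1, ((v (i + 1)).2 : ℤ)) := fun i h h' => by
    refine freeStep_of_step ?_ (hv i (by omega))
    rcases h.lt_or_eq with h | rfl
    · have := hmid i h h'; omega
    · omega
  have hge : ∀ i, i₀ ≤ i → i ≤ τ₂ → lo ≤ (v i).2 := fun i h h' => by
    rcases h.lt_or_eq with h | rfl
    · rcases h'.lt_or_eq with h' | rfl
      · exact (hmid i h h').le
      · omega
    · omega
  obtain ⟨i, hiτ, hiF⟩ := exists_mem_support hF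
    (fun i => ((v (i₀ + i)).1, ((v (i₀ + i)).2 : ℤ))) (τ - i₀) lo w (by omega)
    (by simp [hv₀]) (by rw [Nat.add_sub_cancel' hi₀, hvτ]; push_cast; omega)
    (fun i h => by have := hge (i₀ + i) (by omega) (by omega); dsimp only; omega)
    (fun i h => by have := (hstep (i₀ + i) (by omega)).1; rw [Nat.add_assoc] at this; dsimp only; omega)
    (fun i h => hfree (i₀ + i) (by omega) (by omega))
  -- Read backwards from the return to the floor, the descent is a climb for the reversed
  -- transitions.
  obtain ⟨j, hjσ, hjG⟩ := exists_mem_support hG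
    (fun i => ((v (τ₂ - i)).1, ((v (τ₂ - i)).2 : ℤ))) (τ₂ - σ) lo w (by omega)
    (by simp [hv₂]) (by rw [Nat.sub_sub_self hσ₂, hvσ]; push_cast; omega)
    (fun i h => by have := hge (τ₂ - i) (by omega) (by omega); dsimp only; omega)
    (fun i h => by
      have := (hstep (τ₂ - (i + 1)) (by omega)).2
      rw [show τ₂ - (i + 1) + 1 = τ₂ - i by omega] at this
      dsimp only; omega)
    (fun i h => by
      have := hfree (τ₂ - (i + 1)) (by omega) (by omega)
      rw [show τ₂ - (i + 1) + 1 = τ₂ - i by omega] at this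
      exact freeStep_revTrans.2 this)
  simp only [support, Finset.mem_biUnion] at hiF hjG
  obtain ⟨A, hA, hiA⟩ := hiF
  obtain ⟨B, hB, hjB⟩ := hjG
  have h1 := reflTransGen_low (F := F) (G := G) (lo := lo) v (i₀ + i).zero_le
    (fun t _ h => hv t (by omega)) fun t _ h => hτ' t (by omega)
  have h2 := reflTransGen_flight (F := F) (G := G) hA hB hiA hjB (hge (i₀ + i) (by omega) (by omega))
    (hτ' (i₀ + i) (by omega)) (hge (τ₂ - j) (by omega) (by omega)) (hσ' (τ₂ - j) (by omega) (by omega))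
    (StepsIn.of_fun (fun i => ((v i).1, ((v i).2 : ℤ))) (i := i₀ + i) (j := τ₂ - j) (by omega)
      fun t h h' => hfree t (by omega) (by omega))
  have h3 := reflTransGen_low (F := F) (G := G) (lo := lo) v (Nat.sub_le τ₂ j)
    (fun t _ h => hv t (by omega)) fun t h h' => hσ' t (by omega) h'
  have h4 := ih (N - τ₂) (by omega) (fun i => v (τ₂ + i)) (fun i h => hv (τ₂ + i) (by omega))
    hfl₂ (by rwa [Nat.add_sub_cancel' hτ₂N])
  rw [Nat.add_sub_cancel' hτ₂N] at h4
  exact ((h1.trans h2).trans h3).trans h4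

end

/-! ### Weights, and the realization of abstract walks. -/

section
variable {S : OneCounterSystem Q}

/-- The average number of steps of a pump per unit of its gain. -/
noncomputable def Pump.slowness {T : Set (Q × ℤ × Q)} (A : Pump T) : ℚ := A.K.card / A.gain

theorem Pump.slowness_nonneg {T : Set (Q × ℤ × Q)} (A : Pump T) : 0 ≤ A.slowness := by
  unfold Pump.slowness; positivity

theorem Pump.gain_mul_slowness {T : Set (Q × ℤ × Q)} (A : Pump T) :
    A.gain * A.slowness = A.K.card := by
  have : (A.gain : ℚ) ≠ 0 := by exact_mod_cast A.gain_pos.ne'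
  unfold Pump.slowness; field_simp

theorem Pump.mul_card_le {T : Set (Q × ℤ × Q)} (A : Pump T) {x m : ℕ} (h : x * A.gain ≤ m) :
    (x * A.K.card : ℚ) ≤ m * A.slowness := by
  rw [← A.gain_mul_slowness, ← mul_assoc]
  exact mul_le_mul_of_nonneg_right (by exact_mod_cast h) A.slowness_nonneg

/-- The part of the cost of pumping in `A` before and in `B` after a flight that is independent of
the length of the flight. -/
noncomputable def overhead {T T' : Set (Q × ℤ × Q)} (n : ℕ) (A : Pump T) (B : Pump T') : ℚ :=
  (2 * n * A.slowness + A.K.card) + (A.gain.lcm B.gain : ℕ) * A.slowness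

/-- The number of real steps charged to a vertex of the abstract graph. -/
noncomputable def Node.weight (n : ℕ) : Node S → ℚ
  | .low _ _ => 1
  | .mid A B .takeoff _ _ => overhead n A B
  | .mid A B .cruise _ _ => (1 + A.slowness) + B.slowness
  | .mid A B .landing _ _ => overhead n B A

/-- The remaining walk in the abstract graph, of weight `W`, can be realized; from the middle of a
flight, up to the pumping at its start. -/
def Realizable (n lo hi : ℕ) (y : Q × ℕ) : Node S → ℚ → Prop
  | .low x h, W => ∃ R : ℕ, StepsIn S.Step R (x, h) y ∧ (R : ℚ) ≤ W
  | .mid A B f q l, W => ∃ (t : Q) (h k p R : ℕ) (c l' : ℤ), t ∈ B.K ∧ lo ≤ h ∧ h ≤ hi ∧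
      k ≤ B.K.card ∧ StepsIn (FreeStep (revTrans S.posTrans)) k (t, (h : ℤ)) (B.base, c) ∧
      (B.gain : ℤ) ∣ l' - c ∧ StepsIn (FreeStep S.posTrans) p (q, l) (B.base, l') ∧
      StepsIn S.Step R (t, h) y ∧
      R + overhead n B A + p * (1 + A.slowness + B.slowness) +
        (match f with | .takeoff => overhead n A B | _ => 0) ≤ W

theorem Realizable.of_edge {F : Finset (Pump S.posTrans)}
    {G : Finset (Pump (revTrans S.posTrans))} {n lo w : ℕ} (hn : n ≤ lo)
    (hFG : ∀ A ∈ F, ∀ B ∈ G, A.K.card ≤ n ∧ B.K.card ≤ n ∧ A.K.card + B.K.card + w ≤ 2 * n)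
    {y : Q × ℕ} {u v : Node S} {W : ℚ} (he : Edge F G lo (lo + w) u v)
    (hv : Realizable n lo (lo + w) y v W) :
    Realizable n lo (lo + w) y u (u.weight n + W) := by
  cases he with
  | step h1 h2 h3 =>
    obtain ⟨R, hR, hW⟩ := hv
    exact ⟨R + 1, ⟨_, h1, hR⟩, by simp only [Node.weight]; push_cast; linarith⟩
  | @enter A B s h k l c hA hB hs hlo hhi hk hw hd =>
    obtain ⟨t, h', k', p, R, c', l', ht, hlo', hhi', hk', hw', hd', hp, hR, hW⟩ := hv
    obtain ⟨h1, h2, h3⟩ := hFG A hA B hB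
    obtain ⟨α, hα⟩ := hd
    obtain ⟨β, hβ⟩ := hd'
    -- The three free walks become consecutive after shifting; their joint end then misses `h'` only
    -- by multiples of the two gains.
    have e1 := hp.shift (c - l)
    have e2 := hw'.rev.shift (l' + (c - l) - c')
    rw [show l + (c - l) = c by ring] at e1
    rw [show c' + (l' + (c - l) - c') = l' + (c - l) by ring] at e2
    have e3 := (hw.trans e1).trans e2
    rw [show (h' : ℤ) + (l' + (c - l) - c') = h' + B.gain * β - A.gain * α by
      rw [← hα, ← hβ]; ring] at e3
    obtain ⟨x, z, hx, hz, hst⟩ := exists_pumped_steps hs ht (w := w) (by omega) (by omega)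
      (by omega) (by omega) e3
    refine ⟨_, hst.trans hR, ?_⟩
    -- The joint walk has length `k + p + k'`, and `k + k' + w ≤ 2 * n`; this is the `2 * n` in
    -- `overhead`.
    have hx' := A.mul_card_le (m := p + 2 * n + A.gain.lcm B.gain) (hx.trans (by omega))
    have hz' := B.mul_card_le (m := p + 2 * n + A.gain.lcm B.gain) (hz.trans (by omega))
    have hk1 : (k : ℚ) ≤ A.K.card := by exact_mod_cast hk
    have hk2 : (k' : ℚ) ≤ B.K.card := by exact_mod_cast hk'
    simp only [overhead, Nat.lcm_comm B.gain] at hW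
    simp only [Node.weight]
    push_cast at hx' hz' ⊢
    linarith
  | leave =>
    obtain ⟨t, h', k', p, R, c', l', ht, hlo', hhi', hk', hw', hd', hp, hR, hW⟩ := hv
    refine ⟨t, h', k', p, R, c', l', ht, hlo', hhi', hk', hw', hd', hp, hR, ?_⟩
    simp only [Node.weight] at hW ⊢
    linarith
  | @fly A B _ _ _ _ h1 =>
    obtain ⟨t, h', k', p, R, c', l', ht, hlo', hhi', hk', hw', hd', hp, hR, hW⟩ := hv
    refine ⟨t, h', k', p + 1, R, c', l', ht, hlo', hhi', hk', hw', hd', ⟨_, h1, hp⟩, hR, ?_⟩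
    simp only [Node.weight] at hW ⊢
    push_cast
    linarith
  | @land A B =>
    obtain ⟨t, h', k', p, R, c', l', ht, hlo', hhi', hk', hw', hd', hp, hR, hW⟩ := hv
    refine ⟨t, h', k', p, R, c', l', ht, hlo', hhi', hk', hw', hd', hp, hR, ?_⟩
    have := A.slowness_nonneg
    have := B.slowness_nonneg
    simp only [Node.weight] at hW ⊢
    linarith
  | @exit A B t h k l c hA hB ht hlo hhi hk hw hd =>
    obtain ⟨R, hR, hW⟩ := hv
    refine ⟨t, h, k, 0, R, c, l, ht, hlo, hhi, hk, hw, hd, rfl, hR, ?_⟩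
    simp only [Node.weight]
    push_cast
    linarith

theorem realizable_of_walk {F : Finset (Pump S.posTrans)}
    {G : Finset (Pump (revTrans S.posTrans))} {n lo w : ℕ} (hn : n ≤ lo)
    (hFG : ∀ A ∈ F, ∀ B ∈ G, A.K.card ≤ n ∧ B.K.card ≤ n ∧ A.K.card + B.K.card + w ≤ 2 * n)
    {y : Q} {h : ℕ} (m : ℕ) (v : ℕ → Node S) (hv : ∀ i < m, Edge F G lo (lo + w) (v i) (v (i + 1)))
    (hm : v m = .low y h) :
    Realizable n lo (lo + w) (y, h) (v 0) (∑ i ∈ Finset.range m, (v i).weight n) := by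
  induction m generalizing v with
  | zero => rw [hm]; exact ⟨0, rfl, by simp⟩
  | succ m ih =>
    rw [Finset.sum_range_succ', add_comm (Finset.sum _ _)]
    exact Realizable.of_edge hn hFG (hv 0 (by omega))
      (ih (fun i => v (i + 1)) (fun i hi => hv (i + 1) (by omega)) hm)

end

/-! ### The weight of a shortest abstract path. -/

/-- Double counting of a sum over the keys of its terms. -/
theorem sum_elim_le {ι κ : Type*} (s : Finset ι) (key : ι → Option κ) (K : Finset κ) (N : κ → ℕ)
    (f : κ → ℚ) (hf : ∀ k ∈ K, 0 ≤ f k) (hK : ∀ i ∈ s, ∀ k, key i = some k → k ∈ K)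
    (hN : ∀ k ∈ K, ∀ t ⊆ s, (∀ i ∈ t, key i = some k) → t.card ≤ N k) :
    ∑ i ∈ s, (key i).elim 0 f ≤ ∑ k ∈ K, N k * f k := by
  classical
  calc ∑ i ∈ s, (key i).elim 0 f ≤ ∑ i ∈ s, ∑ k ∈ K, if key i = some k then f k else 0 := by
        refine Finset.sum_le_sum fun i hi => ?_
        cases h : key i with
        | none => simp
        | some k =>
          simp only [Option.elim_some, Option.some.injEq, Finset.sum_ite_eq]
          rw [if_pos (hK i hi k h)]
    _ = ∑ k ∈ K, ∑ i ∈ s, if key i = some k then f k else 0 := Finset.sum_comm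
    _ ≤ ∑ k ∈ K, N k * f k := by
        refine Finset.sum_le_sum fun k hk => ?_
        rw [← Finset.sum_filter, Finset.sum_const, nsmul_eq_mul]
        refine mul_le_mul_of_nonneg_right ?_ (hf k hk)
        exact_mod_cast hN k hk _ (Finset.filter_subset _ _) fun i hi => (Finset.mem_filter.1 hi).2

theorem card_le_of_not_dvd {s : Finset ℕ} (q : ℕ → Q) (l : ℕ → ℤ) (X : Finset Q) {d : ℕ}
    (hd : 0 < d) (hX : ∀ i ∈ s, q i ∈ X)
    (h : ∀ i ∈ s, ∀ j ∈ s, i < j → q i = q j → ¬ (d : ℤ) ∣ l i - l j) : s.card ≤ X.card * d := by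
  have : (X ×ˢ Finset.Ico (0 : ℤ) d).card = X.card * d := by simp
  rw [← this]
  have hd' : (0 : ℤ) < d := by exact_mod_cast hd
  refine Finset.card_le_card_of_injOn (fun i => (q i, l i % d)) (fun i hi => ?_) ?_
  · simp only [Finset.coe_product, Set.mem_prod, Finset.mem_coe, Finset.mem_Ico]
    exact ⟨hX i hi, Int.emod_nonneg _ hd'.ne', Int.emod_lt_of_pos _ hd'⟩
  · intro i hi j hj he
    simp only [Prod.mk.injEq] at he
    rcases lt_trichotomy i j with hij | hij | hij
    · exact absurd (Int.ModEq.dvd he.2.symm) (h i hi j hj hij he.1)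
    · exact hij
    · exact absurd (Int.ModEq.dvd he.2) (h j hj i hi hij he.1.symm)

section
variable {S : OneCounterSystem Q}

namespace Node

/-- The control state of a vertex. -/
def state : Node S → Q
  | .low q _ => q
  | .mid _ _ _ q _ => q

/-- The counter value of a vertex. -/
def level : Node S → ℤ
  | .low _ h => h
  | .mid _ _ _ _ l => l

def lowKey : Node S → Option Unit
  | .low _ _ => some ()
  | .mid _ _ _ _ _ => none

open Classical in
/-- The two pumps of a vertex of the given phase of a flight. -/
noncomputable def key (f : Phase) : Node S → Option (Pump S.posTrans × Pump (revTrans S.posTrans))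
  | .low _ _ => none
  | .mid A B f' _ _ => if f' = f then some (A, B) else none

theorem key_eq_some {f : Phase} {u : Node S} {k} (h : u.key f = some k) :
    u = .mid k.1 k.2 f u.state u.level := by
  cases u with
  | low => simp [key] at h
  | mid A B f' q l =>
    simp only [key, Option.ite_none_right_eq_some, Option.some.injEq] at h
    obtain ⟨rfl, rfl⟩ := h
    rfl

/-- Each summand depends on one pump or on one pair, so each can be counted with its own
multiplicity: gains for single pumps, gcds for pairs. -/
theorem weight_eq (n : ℕ) (u : Node S) : u.weight n =
    u.lowKey.elim 0 (fun _ => 1) +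
    (((u.key .cruise).map Prod.fst).elim 0 (fun A => 1 + A.slowness) +
      ((u.key .cruise).map Prod.snd).elim 0 (fun B => B.slowness)) +
    (((u.key .takeoff).map Prod.fst).elim 0 (fun A => 2 * n * A.slowness + A.K.card) +
      (u.key .takeoff).elim 0 (fun k => (k.1.gain.lcm k.2.gain : ℕ) * k.1.slowness)) +
    (((u.key .landing).map Prod.snd).elim 0 (fun B => 2 * n * B.slowness + B.K.card) +
      (u.key .landing).elim 0 (fun k => (k.2.gain.lcm k.1.gain : ℕ) * k.2.slowness)) := by
  cases u with
  | low => simp [weight, key, lowKey]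
  | mid A B f q l => cases f <;> simp [weight, key, lowKey, overhead]

end Node

/-- Low configurations contribute `n * (hi + 1)`. The 11 is 2 + 1 for cruising, 3 + 1 for takeoff
and 3 + 1 for landing. In the last two phases the state is the base of a pump, which saves a factor
`n` in the count and pays for the overhead. -/
theorem weight_sum_le [Fintype Q] {F : Finset (Pump S.posTrans)}
    {G : Finset (Pump (revTrans S.posTrans))} (hF : IsPumpBasis F) (hG : IsPumpBasis G)
    {lo hi m : ℕ} (v : ℕ → Node S) (hv : ∀ i < m, Edge F G lo hi (v i) (v (i + 1)))
    {x y : Q} {h h' : ℕ} (h0 : v 0 = .low x h) (hm : v m = .low y h')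
    (hmin : ∀ k < m, ¬ StepsIn (Edge F G lo hi) k (.low x h) (.low y h')) :
    ∑ i ∈ Finset.range m, (v i).weight (Fintype.card Q) ≤
      (Fintype.card Q * (hi + 1) : ℕ) + 11 * (Fintype.card Q : ℚ) ^ 2 := by
  obtain ⟨n, hn⟩ : ∃ n, n = Fintype.card Q := ⟨_, rfl⟩
  have hpre : ∀ i ≤ m, StepsIn (Edge F G lo hi) i (.low x h) (v i) := fun i hi => by
    simpa [h0] using StepsIn.of_fun v i.zero_le fun t _ ht => hv t (by omega)
  have hsuf : ∀ i ≤ m, StepsIn (Edge F G lo hi) (m - i) (v i) (.low y h') := fun i hi => by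
    simpa [hm] using StepsIn.of_fun v hi fun t _ ht => hv t (by omega)
  have hmem : ∀ i ≤ m, ∀ f k, (v i).key f = some k → k.1 ∈ F ∧ k.2 ∈ G := fun i hi f k hk => by
    have := hpre i hi
    rw [Node.key_eq_some hk] at this
    exact mem_of_stepsIn_mid this
  have hsep : ∀ i j, i < j → j ≤ m → ∀ f k k', (v i).key f = some k → (v j).key f = some k' →
      (v i).state = (v j).state →
      ¬ ((k.1.gain.gcd k'.2.gain : ℕ) : ℤ) ∣ (v i).level - (v j).level := by
    intro i j hij hj f k k' hk hk' hst
    have e1 := hpre i (by omega)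
    have e2 := hpre j hj
    have e3 := hsuf j hj
    rw [Node.key_eq_some hk] at e1
    rw [Node.key_eq_some hk', ← hst] at e2 e3
    exact not_dvd_of_shortest hmin hij hj e1 e2 e3
  have hsepA : ∀ (A : Pump S.posTrans) f, ∀ t ⊆ Finset.range m,
      (∀ i ∈ t, ((v i).key f).map Prod.fst = some A) → ∀ X : Finset Q, (∀ i ∈ t, (v i).state ∈ X) →
      t.card ≤ X.card * A.gain := by
    intro A f t ht hA X hX
    refine card_le_of_not_dvd (fun i => (v i).state) (fun i => (v i).level) X A.gain_pos hX ?_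
    intro i hi j hj hij hst hd
    obtain ⟨k, hk, rfl⟩ := Option.map_eq_some_iff.1 (hA i hi)
    obtain ⟨k', hk', -⟩ := Option.map_eq_some_iff.1 (hA j hj)
    refine hsep i j hij (Finset.mem_range.1 (ht hj)).le f k k' hk hk' hst (dvd_trans ?_ hd)
    exact_mod_cast Nat.gcd_dvd_left _ _
  have hsepB : ∀ (B : Pump (revTrans S.posTrans)) f, ∀ t ⊆ Finset.range m,
      (∀ i ∈ t, ((v i).key f).map Prod.snd = some B) → ∀ X : Finset Q, (∀ i ∈ t, (v i).state ∈ X) →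
      t.card ≤ X.card * B.gain := by
    intro B f t ht hB X hX
    refine card_le_of_not_dvd (fun i => (v i).state) (fun i => (v i).level) X B.gain_pos hX ?_
    intro i hi j hj hij hst hd
    obtain ⟨k, hk, -⟩ := Option.map_eq_some_iff.1 (hB i hi)
    obtain ⟨k', hk', rfl⟩ := Option.map_eq_some_iff.1 (hB j hj)
    refine hsep i j hij (Finset.mem_range.1 (ht hj)).le f k k' hk hk' hst (dvd_trans ?_ hd)
    exact_mod_cast Nat.gcd_dvd_right _ _
  have hsepAB : ∀ k f, ∀ t ⊆ Finset.range m, (∀ i ∈ t, (v i).key f = some k) →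
      ∀ X : Finset Q, (∀ i ∈ t, (v i).state ∈ X) → t.card ≤ X.card * k.1.gain.gcd k.2.gain := by
    intro k f t ht hk X hX
    refine card_le_of_not_dvd (fun i => (v i).state) (fun i => (v i).level) X
      (Nat.gcd_pos_of_pos_left _ k.1.gain_pos) hX ?_
    intro i hi j hj hij hst hd
    exact hsep i j hij (Finset.mem_range.1 (ht hj)).le f k k (hk i hi) (hk j hj) hst hd
  have htake : ∀ i ∈ Finset.range m, ∀ k, (v i).key .takeoff = some k →
      (v i).state ∈ ({k.1.base} : Finset Q) := by
    intro i hi k hk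
    have := hpre i (Finset.mem_range.1 hi).le
    rw [Node.key_eq_some hk] at this
    simpa using base_of_stepsIn_takeoff this
  have hland : ∀ i ∈ Finset.range m, ∀ k, (v i).key .landing = some k →
      (v i).state ∈ ({k.2.base} : Finset Q) := by
    intro i hi k hk
    have := hsuf i (Finset.mem_range.1 hi).le
    rw [Node.key_eq_some hk] at this
    simpa using base_of_landing_stepsIn this
  have hmemA : ∀ f, ∀ i ∈ Finset.range m, ∀ A, ((v i).key f).map Prod.fst = some A → A ∈ F := by
    intro f i hi A hA
    obtain ⟨k, hk, rfl⟩ := Option.map_eq_some_iff.1 hA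
    exact (hmem i (Finset.mem_range.1 hi).le f k hk).1
  have hmemB : ∀ f, ∀ i ∈ Finset.range m, ∀ B, ((v i).key f).map Prod.snd = some B → B ∈ G := by
    intro f i hi A hA
    obtain ⟨k, hk, rfl⟩ := Option.map_eq_some_iff.1 hA
    exact (hmem i (Finset.mem_range.1 hi).le f k hk).2
  have hmemAB : ∀ f, ∀ i ∈ Finset.range m, ∀ k, (v i).key f = some k → k ∈ F ×ˢ G := by
    intro f i hi k hk
    exact Finset.mem_product.2 (hmem i (Finset.mem_range.1 hi).le f k hk)
  have hsF : ∑ A ∈ F, (A.K.card : ℚ) ≤ n := by rw [hn]; exact_mod_cast hF.sum_card_le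
  have hsG : ∑ B ∈ G, (B.K.card : ℚ) ≤ n := by rw [hn]; exact_mod_cast hG.sum_card_le
  have hgA : ∀ A : Pump S.posTrans, (A.gain : ℚ) ≤ A.K.card := fun A => by exact_mod_cast A.gain_le
  have hgB : ∀ B : Pump (revTrans S.posTrans), (B.gain : ℚ) ≤ B.K.card := fun B => by
    exact_mod_cast B.gain_le_of_rev
  have hcA : ∀ A : Pump S.posTrans, (A.K.card : ℚ) ≤ n := fun A => by
    rw [hn]; exact_mod_cast A.K.card_le_univ
  have hcB : ∀ B : Pump (revTrans S.posTrans), (B.K.card : ℚ) ≤ n := fun B => by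
    rw [hn]; exact_mod_cast B.K.card_le_univ
  have hnn : (0 : ℚ) ≤ n := by positivity
  have hgl : ∀ a b : ℕ, ((a.gcd b : ℕ) : ℚ) * (a.lcm b : ℕ) = a * b := fun a b => by
    exact_mod_cast Nat.gcd_mul_lcm a b
  have hprod : ∑ k ∈ F ×ˢ G, (k.1.K.card : ℚ) * k.2.K.card ≤ (n : ℚ) ^ 2 := by
    rw [Finset.sum_product, pow_two]
    dsimp only
    rw [← Finset.sum_mul_sum]
    exact mul_le_mul hsF hsG (Finset.sum_nonneg fun _ _ => by positivity) hnn
  -- configurations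
  have s1 := sum_elim_le (Finset.range m) (fun i => (v i).lowKey) {()} (fun _ => n * (hi + 1))
    (fun _ => 1) (by simp) (by simp) (by
      intro _ _ t ht hk
      have hlow : ∀ i ∈ t, ∃ c : ℕ, c ≤ hi ∧ v i = .low (v i).state c ∧ (v i).level = c := by
        intro i hi
        have e1 := hk i hi
        have e2 := hv i (Finset.mem_range.1 (ht hi))
        generalize v i = u, v (i + 1) = u' at e1 e2
        cases e2 with
        | step => exact ⟨_, by assumption, rfl, rfl⟩
        | enter => exact ⟨_, by assumption, rfl, rfl⟩
        | _ => simp [Node.lowKey] at e1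
      rw [hn, ← Finset.card_univ]
      -- Counters between 0 and `hi` that are congruent modulo `hi + 1` are equal.
      refine card_le_of_not_dvd (fun i => (v i).state) (fun i => (v i).level) _ (Nat.succ_pos hi)
        (by simp) ?_
      intro i hi' j hj hij hst hd
      obtain ⟨c, hc, e1, e2⟩ := hlow i hi'
      obtain ⟨c', hc', e1', e2'⟩ := hlow j hj
      rw [e2, e2'] at hd
      have hcc : (c : ℤ) - c' = 0 := Int.eq_zero_of_abs_lt_dvd hd (by rw [abs_lt]; omega)
      have hcc : c = c' := by omega
      have hjm := Finset.mem_range.1 (ht hj)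
      have e3 := hpre i (by omega)
      have e4 := hsuf j hjm.le
      rw [e1, hst, hcc, ← e1'] at e3
      exact hmin _ (by omega) (e3.trans e4))
  -- the stages of flights
  have s2 := sum_elim_le (Finset.range m) (fun i => ((v i).key .cruise).map Prod.fst) F
    (fun A => n * A.gain) (fun A => 1 + A.slowness)
    (fun A _ => by have := A.slowness_nonneg; positivity) (hmemA _)
    (fun A _ t ht hA => by
      rw [hn, ← Finset.card_univ]; exact hsepA A _ t ht hA _ (by simp))
  have s3 := sum_elim_le (Finset.range m) (fun i => ((v i).key .cruise).map Prod.snd) G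
    (fun B => n * B.gain) (fun B => B.slowness)
    (fun B _ => B.slowness_nonneg) (hmemB _)
    (fun B _ t ht hB => by
      rw [hn, ← Finset.card_univ]; exact hsepB B _ t ht hB _ (by simp))
  have s4 := sum_elim_le (Finset.range m) (fun i => ((v i).key .takeoff).map Prod.fst) F
    (fun A => A.gain) (fun A => 2 * n * A.slowness + A.K.card)
    (fun A _ => by have := A.slowness_nonneg; positivity) (hmemA _)
    (fun A _ t ht hA => by
      have := hsepA A _ t ht hA {A.base} (fun i hi => by
        obtain ⟨k, hk, rfl⟩ := Option.map_eq_some_iff.1 (hA i hi)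
        exact htake i (ht hi) k hk)
      simpa using this)
  have s5 := sum_elim_le (Finset.range m) (fun i => (v i).key .takeoff) (F ×ˢ G)
    (fun k => k.1.gain.gcd k.2.gain) (fun k => (k.1.gain.lcm k.2.gain : ℕ) * k.1.slowness)
    (fun k _ => by have := k.1.slowness_nonneg; positivity) (hmemAB _)
    (fun k _ t ht hk => by
      simpa using hsepAB k _ t ht hk {k.1.base} (fun i hi => htake i (ht hi) k (hk i hi)))
  have s6 := sum_elim_le (Finset.range m) (fun i => ((v i).key .landing).map Prod.snd) G
    (fun B => B.gain) (fun B => 2 * n * B.slowness + B.K.card)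
    (fun B _ => by have := B.slowness_nonneg; positivity) (hmemB _)
    (fun B _ t ht hB => by
      have := hsepB B _ t ht hB {B.base} (fun i hi => by
        obtain ⟨k, hk, rfl⟩ := Option.map_eq_some_iff.1 (hB i hi)
        exact hland i (ht hi) k hk)
      simpa using this)
  have s7 := sum_elim_le (Finset.range m) (fun i => (v i).key .landing) (F ×ˢ G)
    (fun k => k.1.gain.gcd k.2.gain) (fun k => (k.2.gain.lcm k.1.gain : ℕ) * k.2.slowness)
    (fun k _ => by have := k.2.slowness_nonneg; positivity) (hmemAB _)
    (fun k _ t ht hk => by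
      simpa using hsepAB k _ t ht hk {k.2.base} (fun i hi => hland i (ht hi) k (hk i hi)))
  have b2 : ∑ A ∈ F, ((n * A.gain : ℕ) : ℚ) * (1 + A.slowness) ≤ 2 * (n : ℚ) ^ 2 := by
    calc _ ≤ ∑ A ∈ F, 2 * n * (A.K.card : ℚ) := Finset.sum_le_sum fun A _ => by
          push_cast
          have := A.gain_mul_slowness
          have := mul_le_mul_of_nonneg_left (hgA A) hnn
          linear_combination this + n * A.gain_mul_slowness
      _ ≤ _ := by
          rw [← Finset.mul_sum]
          linear_combination (2 * n : ℚ) * hsF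
  have b3 : ∑ B ∈ G, ((n * B.gain : ℕ) : ℚ) * B.slowness ≤ (n : ℚ) ^ 2 := by
    calc _ = ∑ B ∈ G, n * (B.K.card : ℚ) := Finset.sum_congr rfl fun B _ => by
          push_cast
          linear_combination n * B.gain_mul_slowness
      _ ≤ _ := by
          rw [← Finset.mul_sum]
          linear_combination (n : ℚ) * hsG
  have b4 : ∑ A ∈ F, (A.gain : ℚ) * (2 * n * A.slowness + A.K.card) ≤ 3 * (n : ℚ) ^ 2 := by
    calc _ ≤ ∑ A ∈ F, 3 * n * (A.K.card : ℚ) := Finset.sum_le_sum fun A _ => by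
          have := mul_le_mul_of_nonneg_right ((hgA A).trans (hcA A)) (Nat.cast_nonneg (α := ℚ) A.K.card)
          linear_combination this + 2 * n * A.gain_mul_slowness
      _ ≤ _ := by
          rw [← Finset.mul_sum]
          linear_combination (3 * n : ℚ) * hsF
  have b6 : ∑ B ∈ G, (B.gain : ℚ) * (2 * n * B.slowness + B.K.card) ≤ 3 * (n : ℚ) ^ 2 := by
    calc _ ≤ ∑ B ∈ G, 3 * n * (B.K.card : ℚ) := Finset.sum_le_sum fun B _ => by
          have := mul_le_mul_of_nonneg_right ((hgB B).trans (hcB B)) (Nat.cast_nonneg (α := ℚ) B.K.card)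
          linear_combination this + 2 * n * B.gain_mul_slowness
      _ ≤ _ := by
          rw [← Finset.mul_sum]
          linear_combination (3 * n : ℚ) * hsG
  -- The gcd from counting and the lcm from the overhead multiply to the product of the gains, and
  -- each gain is at most the length of its cycle.
  have b5 : ∑ k ∈ F ×ˢ G, ((k.1.gain.gcd k.2.gain : ℕ) : ℚ) *
      ((k.1.gain.lcm k.2.gain : ℕ) * k.1.slowness) ≤ (n : ℚ) ^ 2 := by
    refine le_trans (Finset.sum_le_sum fun k _ => ?_) hprod
    rw [← mul_assoc, hgl, mul_right_comm, k.1.gain_mul_slowness]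
    exact mul_le_mul_of_nonneg_left (hgB _) (Nat.cast_nonneg _)
  have b7 : ∑ k ∈ F ×ˢ G, ((k.1.gain.gcd k.2.gain : ℕ) : ℚ) *
      ((k.2.gain.lcm k.1.gain : ℕ) * k.2.slowness) ≤ (n : ℚ) ^ 2 := by
    refine le_trans (Finset.sum_le_sum fun k _ => ?_) hprod
    rw [Nat.lcm_comm, ← mul_assoc, hgl, mul_assoc, k.2.gain_mul_slowness]
    exact mul_le_mul_of_nonneg_right (hgA _) (Nat.cast_nonneg _)
  rw [← hn]
  simp only [Node.weight_eq, Finset.sum_add_distrib]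
  rw [Finset.sum_singleton, mul_one] at s1
  linarith

/-! ### Conclusion. -/

/-- The bound on shortest paths, for sequences of steps. -/
theorem exists_short_steps [Fintype Q] {pα pβ : Q} {cα cβ : ℕ}
    (hreach : S.Reachable (pα, cα) (pβ, cβ)) :
    ∃ R ≤ 14 * Fintype.card Q ^ 2 + Fintype.card Q * max cα cβ,
      StepsIn S.Step R (pα, cα) (pβ, cβ) := by
  classical
  obtain ⟨n, hn⟩ : ∃ n, n = Fintype.card Q := ⟨_, rfl⟩
  have hn1 : 1 ≤ n := by
    rw [hn]; exact Fintype.card_pos_iff.2 ⟨pα⟩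
  obtain ⟨F, hF⟩ := exists_isPumpBasis S.posTrans
  obtain ⟨G, hG⟩ := exists_isPumpBasis (revTrans S.posTrans)
  -- The band must suit both bases. Still, `A.K.card + B.K.card + w` is at most `n` plus the larger
  -- support, hence at most `2 * n`.
  obtain ⟨w, hw⟩ : ∃ w, w = n - min (support F).card (support G).card := ⟨_, rfl⟩
  have huF := (support F).card_le_univ
  have huG := (support G).card_le_univ
  obtain ⟨M, hM⟩ : ∃ M, M = max cα cβ := ⟨_, rfl⟩
  obtain ⟨N, hN⟩ := StepsIn.of_reflTransGen hreach
  obtain ⟨v, hv0, hvN, hv⟩ := hN.exists_fun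
  -- The floor `M + n` lies above both end configurations and leaves room `n` for a turn of any
  -- pump.
  have hG' := reflTransGen_of_steps hF hG (lo := M + n) (w := w) (by omega) (by omega) (by omega)
    rfl N v hv (by rw [hv0]; simp only; omega) (by rw [hvN]; simp only; omega)
  rw [hv0, hvN] at hG'
  have hex := StepsIn.of_reflTransGen hG'
  have hmin := fun m (hm : m < Nat.find hex) => Nat.find_min hex hm
  obtain ⟨u, hu0, hum, hu⟩ := (Nat.find_spec hex).exists_fun
  have hsum := weight_sum_le hF hG u hu hu0 hum hmin
  have hreal := realizable_of_walk (n := n) (by omega) (fun A hA B hB => by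
    have := card_le_card_support hA
    have := card_le_card_support hB
    omega) _ u hu hum
  rw [hu0] at hreal
  obtain ⟨R, hR, hW⟩ := hreal
  refine ⟨R, ?_, hR⟩
  rw [← hn, ← hM]
  rw [← hn] at hsum
  have hRle : R ≤ n * (M + n + w + 1) + 11 * n ^ 2 := by exact_mod_cast hW.trans hsum
  have hwn : w ≤ n := by omega
  -- With `w ≤ n` and `1 ≤ n`, the low part is at most `n * M + 3 * n ^ 2`, and 3 + 11 = 14.
  nlinarith [Nat.mul_le_mul_left n hwn, Nat.mul_le_mul_left n hn1]

end

end OneCounterSystem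

theorem theorem2 {Q : Type*} [Fintype Q] (n : ℕ) (hn : Fintype.card Q = n)
    (S : OneCounterSystem Q) (pα pβ : Q) (cα cβ : ℕ)
    (hreach : S.Reachable (pα, cα) (pβ, cβ)) :
    ∃ π : S.Path, π.head = (pα, cα) ∧ π.last = (pβ, cβ) ∧
      π.length ≤ 14 * n ^ 2 + n * max cα cβ := by
  subst hn
  obtain ⟨R, hR, hsteps⟩ := OneCounterSystem.exists_short_steps hreach
  obtain ⟨v, h0, hk, hv⟩ := hsteps.exists_fun
  exact ⟨⟨R, fun i => v i, fun i => hv i i.2⟩, h0, hk, hR⟩
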